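/- Let $d\in\mathbb N$ and let $\mathcal P_2(\mathbb R^d)$ be the set of Borel probability measures on $\mathbb R^d$ with finite quadratic moment $\int|x|^2\,d\mu<\infty$. For $\mu,\nu\in\mathcal P_2(\mathbb R^d)$ let $$W_2^2(\mu,\nu)=\inf_{\gamma}\int_{\mathbb R^d\times\mathbb R^d}|x-y|^2\,d\gamma(x,y),$$ where $\gamma$ ranges over the measures on $\mathbb R^d\times\mathbb R^d$ with marginals $\mu$ and $\nu$. Let $W:\mathbb R^d\to\mathbb R$ satisfy: (A) $W$ is continuous, $W(-x)=W(x)$ for all $x$, $W(0)=0$ and $W\in C^1(\mathbb R^d\setminus\{0\})$; (B) there is a constant $C>0$ with $W(z)\le C(1+|z|^2)$ for all $z\in\mathbb R^d$; (C') $\lambda',\lambda''\ge 0$ are such that $x\mapsto W(x)+\frac{\lambda''}{2}|x|^2+\lambda'|x|$ is convex on $\mathbb R^d$. Put $$\mathcal W[\mu]=\frac12\int_{\mathbb R^d\times\mathbb R^d}W(x-y)\,d\mu(x)\,d\mu(y),\qquad \lambda^-=\max\{0,\lambda',\lambda''\}.$$ Then, for every fixed $\bar\mu\in\mathcal P_2(\mathbb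 R^d)$ and every $\tau>0$ with $12\,\tau\lambda^-\le 1$, the functional $$\mathcal P_2(\mathbb R^d)\ni\mu\longmapsto \mathcal W[\mu]+\frac1{2\tau}W_2^2(\mu,\bar\mu)\in\mathbb R$$ is lower semicontinuous with respect to the narrow topology, that is, the topology of convergence of integrals of bounded continuous functions. -/

import Mathlib

open MeasureTheory
open scoped ENNReal

/-- The Euclidean space `ℝ^d`. -/
abbrev Space (d : ℕ) : Type := EuclideanSpace ℝ (Fin d)

/-- Borel probability measures on `ℝ^d` with finite quadratic moment. As a subtype of
`ProbabilityMeasure`, whose topology is that of narrow convergence (convergence of the integrals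
of bounded continuous functions), it carries the induced narrow topology. -/
abbrev P2 (d : ℕ) : Type :=
  {μ : ProbabilityMeasure (Space d) // ∫⁻ x, ‖x‖ₑ ^ 2 ∂(μ : Measure (Space d)) < ∞}

/-- The underlying Borel measure of an element of `P2 d`. -/
abbrev P2.toMeasure {d : ℕ} (μ : P2 d) : Measure (Space d) := (μ.1 : Measure (Space d))

/-- Transport plans between `μ` and `ν`: measures on the product with marginals `μ` and `ν`. -/
def transportPlans {d : ℕ} (μ ν : Measure (Space d)) : Set (Measure (Space d × Space d)) :=
  {γ | γ.map Prod.fst = μ ∧ γ.map Prod.snd = ν}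

/-- The quadratic Wasserstein distance
`W₂(μ, ν) = (inf_γ ∫ |x - y|² dγ(x, y))^(1/2)`, the infimum being over all transport plans. -/
noncomputable def wassersteinTwo {d : ℕ} (μ ν : Measure (Space d)) : ℝ≥0∞ :=
  (⨅ γ ∈ transportPlans μ ν, ∫⁻ p, edist p.1 p.2 ^ 2 ∂γ) ^ (1 / 2 : ℝ)

/-- The interaction energy `𝒲[μ] = (1/2) ∬ W(x - y) dμ(x) dμ(y)`. -/
noncomputable def interactionEnergy {d : ℕ} (W : Space d → ℝ) (μ : Measure (Space d)) : ℝ :=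
  (1 / 2) * ∫ p, W (p.1 - p.2) ∂(μ.prod μ)

/-- The penalized interaction energy `𝒲[μ] + (1/(2τ)) W₂²(μ, μ̄)` on `P2 d`. -/
noncomputable def penalizedEnergy {d : ℕ} (W : Space d → ℝ) (τ : ℝ) (μbar μ : P2 d) : ℝ :=
  interactionEnergy W μ.toMeasure
    + 1 / (2 * τ) * (wassersteinTwo μ.toMeasure μbar.toMeasure).toReal ^ 2

/-- The assumptions on the interaction potential: continuity, evenness, normalization and `C¹`
regularity away from the origin; a quadratic upper bound; and convexity of
`x ↦ W x + (l₂ / 2) |x|² + l₁ |x|`, where `l₁, l₂ ≥ 0`. -/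
structure IsAdmissiblePotential {d : ℕ} (W : Space d → ℝ) (l₁ l₂ : ℝ) : Prop where
  continuous : Continuous W
  even : ∀ x, W (-x) = W x
  map_zero : W 0 = 0
  contDiffOn : ContDiffOn ℝ 1 W {0}ᶜ
  upper_bound : ∃ C : ℝ, 0 < C ∧ ∀ z, W z ≤ C * (1 + ‖z‖ ^ 2)
  nonneg_left : 0 ≤ l₁
  nonneg_right : 0 ≤ l₂
  convexOn : ConvexOn ℝ Set.univ fun x => W x + l₂ / 2 * ‖x‖ ^ 2 + l₁ * ‖x‖

/-- The integral in `interactionEnergy` converges absolutely on `P2 d`. -/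
theorem integrable_interaction {d : ℕ} {W : Space d → ℝ} {l₁ l₂ : ℝ}
    (hW : IsAdmissiblePotential W l₁ l₂) (μ : P2 d) :
    Integrable (fun p : Space d × Space d => W (p.1 - p.2))
      (μ.toMeasure.prod μ.toMeasure) := by
  obtain ⟨C, hC, hub⟩ := hW.upper_bound
  have hlow : ∀ z, 0 ≤ W z + l₂ / 2 * ‖z‖ ^ 2 + l₁ * ‖z‖ := by
    intro z
    have h := hW.convexOn.2 (Set.mem_univ z) (Set.mem_univ (-z))
      (by norm_num : (0 : ℝ) ≤ 1 / 2) (by norm_num : (0 : ℝ) ≤ 1 / 2) (by norm_num)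
    simp only [smul_neg, add_neg_cancel, hW.map_zero, hW.even, norm_neg, norm_zero,
      smul_eq_mul] at h
    nlinarith
  have hsq : Integrable (fun x : Space d => ‖x‖ ^ 2) μ.toMeasure := by
    refine ⟨by fun_prop, ?_⟩
    rw [HasFiniteIntegral]
    simpa using μ.2
  have hsum : Integrable (fun p : Space d × Space d =>
      (C + l₁ + l₂) * (1 + 2 * ‖p.1‖ ^ 2 + 2 * ‖p.2‖ ^ 2))
      (μ.toMeasure.prod μ.toMeasure) :=
    (((integrable_const 1).add ((hsq.comp_fst _).const_mul 2)).add
      ((hsq.comp_snd _).const_mul 2)).const_mul _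
  have hc := hW.continuous
  refine hsum.mono' (by fun_prop) (Filter.Eventually.of_forall fun p => ?_)
  have h1 := hub (p.1 - p.2)
  have h2 := hlow (p.1 - p.2)
  have h3 := norm_sub_le p.1 p.2
  have h0 := norm_nonneg (p.1 - p.2)
  have h4 : ‖p.1 - p.2‖ ^ 2 ≤ 2 * ‖p.1‖ ^ 2 + 2 * ‖p.2‖ ^ 2 := by
    nlinarith [sq_nonneg (‖p.1‖ - ‖p.2‖)]
  have hl₁ := hW.nonneg_left
  have hl₂ := hW.nonneg_right
  have h5 : (C + l₁ + l₂) * (1 + ‖p.1 - p.2‖ ^ 2) ≤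
      (C + l₁ + l₂) * (1 + 2 * ‖p.1‖ ^ 2 + 2 * ‖p.2‖ ^ 2) :=
    mul_le_mul_of_nonneg_left (by linarith) (by linarith)
  refine le_trans ?_ h5
  set r := ‖p.1 - p.2‖
  have h6 : l₁ * r ≤ l₁ * (1 + r ^ 2) :=
    mul_le_mul_of_nonneg_left (by nlinarith [sq_nonneg (r - 1)]) hl₁
  have h7 : 0 ≤ l₂ * r ^ 2 := by positivity
  have h8 : 0 ≤ C * (1 + r ^ 2) := by positivity
  have h9 : 0 ≤ l₁ * (1 + r ^ 2) := by positivity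
  rw [Real.norm_eq_abs, abs_le]
  constructor <;> nlinarith

/-- The quadratic Wasserstein distance is finite on `P2 d`. -/
theorem wassersteinTwo_ne_top {d : ℕ} (μ ν : P2 d) :
    wassersteinTwo μ.toMeasure ν.toMeasure ≠ ∞ := by
  refine ENNReal.rpow_ne_top_of_nonneg (by norm_num) (ne_of_lt ?_)
  refine lt_of_le_of_lt (iInf₂_le (μ.toMeasure.prod ν.toMeasure) ⟨by simp, by simp⟩) ?_
  have hsq : ∀ ρ : P2 d, MemLp (fun x : Space d => x) 2 ρ.toMeasure := by
    intro ρ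
    rw [memLp_two_iff_integrable_sq_norm (by fun_prop)]
    refine ⟨by fun_prop, ?_⟩
    rw [HasFiniteIntegral]
    simpa using ρ.2
  have h : MemLp (fun p : Space d × Space d => p.1 - p.2) 2
      (μ.toMeasure.prod ν.toMeasure) :=
    ((hsq μ).comp_fst _).sub ((hsq ν).comp_snd _)
  rw [memLp_two_iff_integrable_sq_norm (by fun_prop)] at h
  have h' := h.2
  rw [HasFiniteIntegral] at h'
  simpa [edist_eq_enorm_sub] using h'

/-! By convexity and evenness, `W` is bounded below by a negative function of at most quadratic
growth, so `𝒲` alone need not be lower semicontinuous; the transport cost compensates. For a plan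
`γ` from `μ` to `μbar`, the interaction plus the cost of `γ` is an integral over `γ ⊗ γ`. Since `|x₁
- x₂|` is controlled by `|x₁ - y₁|`, `|x₂ - y₂|`, `|y₁|`, `|y₂|`, for small `τ` the integrand
becomes nonnegative after adding a quadratic function of `y₁, y₂` (`penalizedDensity_nonneg`). This
shift integrates to a constant because the second marginal is fixed. Near-optimal plans along a
narrowly convergent sequence are tight, hence subconverge to a plan `γ` for the limit; then `γ ⊗ γ`
is the limit of the products, and nonnegative continuous integrands are lower semicontinuous. -/

open Filter Topology

section PlanCompactness

variable {E F : Type*} [MetricSpace E] [CompleteSpace E] [SecondCountableTopology E]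
  [MeasurableSpace E] [BorelSpace E] [MetricSpace F] [CompleteSpace F]
  [SecondCountableTopology F] [MeasurableSpace F] [BorelSpace F]

/-- Couplings of a narrowly convergent sequence with a fixed measure have a subsequence which
converges narrowly to a coupling of the limits. -/
theorem exists_subseq_tendsto_coupling {μs : ℕ → ProbabilityMeasure E} {μ : ProbabilityMeasure E}
    (hμ : Tendsto μs atTop (𝓝 μ)) {ν : ProbabilityMeasure F}
    {γs : ℕ → ProbabilityMeasure (E × F)}
    (hfst : ∀ n, (γs n).map measurable_fst.aemeasurable = μs n)
    (hsnd : ∀ n, (γs n).map measurable_snd.aemeasurable = ν) :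
    ∃ γ : ProbabilityMeasure (E × F), γ.map measurable_fst.aemeasurable = μ ∧
      γ.map measurable_snd.aemeasurable = ν ∧
      ∃ φ : ℕ → ℕ, StrictMono φ ∧ Tendsto (γs ∘ φ) atTop (𝓝 γ) := by
  have hK : IsCompact (insert μ (Set.range μs)) := hμ.isCompact_insert_range
  have htight₁ := isTightMeasureSet_of_isCompact_closure (hK.isClosed.closure_eq.symm ▸ hK)
  have htight₂ : IsTightMeasureSet {(ν : Measure F)} := isTightMeasureSet_singleton
  have htight : IsTightMeasureSet
      {((γ : ProbabilityMeasure (E × F)) : Measure (E × F)) | γ ∈ Set.range γs} := by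
    refine IsTightMeasureSet.prodMk (htight₁.subset ?_) (htight₂.subset ?_)
    · rintro _ ⟨_, ⟨_, ⟨n, rfl⟩, rfl⟩, rfl⟩
      exact ⟨μs n, Or.inr ⟨n, rfl⟩, by rw [← hfst n]; rfl⟩
    · rintro _ ⟨_, ⟨_, ⟨n, rfl⟩, rfl⟩, rfl⟩
      rw [Set.mem_singleton_iff, ← hsnd n]; rfl
  obtain ⟨γ, -, φ, hφ, hlim⟩ := (isCompact_closure_of_isTightMeasureSet htight).tendsto_subseq
    (fun n => subset_closure ⟨n, rfl⟩ : ∀ n, γs n ∈ closure (Set.range γs))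
  refine ⟨γ, ?_, ?_, φ, hφ, hlim⟩
  -- Continuity of the projections lets both marginals pass to the limit.
  · refine tendsto_nhds_unique
      (ProbabilityMeasure.tendsto_map_of_tendsto_of_continuous _ _ hlim continuous_fst) ?_
    simp only [Function.comp_apply, hfst]
    exact hμ.comp hφ.tendsto_atTop
  · refine tendsto_nhds_unique
      (ProbabilityMeasure.tendsto_map_of_tendsto_of_continuous _ _ hlim continuous_snd) ?_
    simp only [Function.comp_apply, hsnd, tendsto_const_nhds]

end PlanCompactness

/-- Integrals of nonnegative continuous functions are sequentially narrowly lower semicontinuous. -/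
theorem lintegral_le_of_tendsto_of_forall_le {Ω : Type*} [MeasurableSpace Ω] [TopologicalSpace Ω]
    [OpensMeasurableSpace Ω] [HasOuterApproxClosed Ω] {μs : ℕ → ProbabilityMeasure Ω}
    {μ : ProbabilityMeasure Ω} (hμ : Tendsto μs atTop (𝓝 μ)) {f : Ω → ℝ} (hf : Continuous f)
    (hf0 : 0 ≤ f) {c : ℝ≥0∞} (hc : ∀ n, ∫⁻ x, ENNReal.ofReal (f x) ∂(μs n : Measure Ω) ≤ c) :
    ∫⁻ x, ENNReal.ofReal (f x) ∂(μ : Measure Ω) ≤ c := by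
  refine (lintegral_le_liminf_lintegral_of_forall_isOpen_measure_le_liminf_measure hf hf0
    fun G hG => ProbabilityMeasure.le_liminf_measure_open_of_tendsto hμ hG).trans ?_
  exact (liminf_le_liminf (Eventually.of_forall hc)).trans (liminf_const c).le

section Interaction

variable {d : ℕ}

theorem isProbabilityMeasure_of_mem_transportPlans {μ ν : Measure (Space d)}
    [IsProbabilityMeasure μ] {γ : Measure (Space d × Space d)} (hγ : γ ∈ transportPlans μ ν) :
    IsProbabilityMeasure γ := by
  refine ⟨?_⟩
  rw [← Set.preimage_univ (f := Prod.fst), ← Measure.map_apply measurable_fst .univ, hγ.1,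
    measure_univ]

theorem P2.integrable_norm_sq (μ : P2 d) : Integrable (fun x => ‖x‖ ^ 2) μ.toMeasure := by
  refine ⟨by fun_prop, ?_⟩
  rw [HasFiniteIntegral]
  simpa using μ.2

theorem integrable_norm_snd_sq_of_mem_transportPlans {μ : Measure (Space d)} {ν : P2 d}
    {γ : Measure (Space d × Space d)} (hγ : γ ∈ transportPlans μ ν.toMeasure) :
    Integrable (fun p : Space d × Space d => ‖p.2‖ ^ 2) γ :=
  Integrable.comp_measurable (f := Prod.snd) (g := fun x => ‖x‖ ^ 2)
    (hγ.2 ▸ ν.integrable_norm_sq) measurable_snd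

theorem integrable_norm_sub_sq_of_mem_transportPlans {μ ν : P2 d}
    {γ : Measure (Space d × Space d)} (hγ : γ ∈ transportPlans μ.toMeasure ν.toMeasure) :
    Integrable (fun p : Space d × Space d => ‖p.1 - p.2‖ ^ 2) γ := by
  have h₁ : Integrable (fun p : Space d × Space d => ‖p.1‖ ^ 2) γ :=
    Integrable.comp_measurable (f := Prod.fst) (g := fun x => ‖x‖ ^ 2)
      (hγ.1 ▸ μ.integrable_norm_sq) measurable_fst
  have h₂ := integrable_norm_snd_sq_of_mem_transportPlans hγ
  refine ((h₁.const_mul 2).add (h₂.const_mul 2)).mono' (by fun_prop) (Eventually.of_forall ?_)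
  intro p
  have h := norm_sub_le p.1 p.2
  have h0 := norm_nonneg (p.1 - p.2)
  simp only [Pi.add_apply, norm_pow, norm_norm]
  nlinarith [sq_nonneg (‖p.1‖ - ‖p.2‖)]

theorem lintegral_edist_sq_of_mem_transportPlans {μ ν : P2 d}
    {γ : Measure (Space d × Space d)} (hγ : γ ∈ transportPlans μ.toMeasure ν.toMeasure) :
    ∫⁻ p, edist p.1 p.2 ^ 2 ∂γ = ENNReal.ofReal (∫ p, ‖p.1 - p.2‖ ^ 2 ∂γ) := by
  rw [ofReal_integral_eq_lintegral_ofReal (integrable_norm_sub_sq_of_mem_transportPlans hγ)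
    (Eventually.of_forall fun p => sq_nonneg _)]
  refine lintegral_congr fun p => ?_
  rw [edist_eq_enorm_sub, ENNReal.ofReal_pow (norm_nonneg _), ofReal_norm]

theorem wassersteinTwo_sq (μ ν : Measure (Space d)) :
    wassersteinTwo μ ν ^ 2 = ⨅ γ ∈ transportPlans μ ν, ∫⁻ p, edist p.1 p.2 ^ 2 ∂γ := by
  rw [wassersteinTwo, ← ENNReal.rpow_natCast, ← ENNReal.rpow_mul]
  norm_num

theorem toReal_wassersteinTwo_sq_le_integral {μ ν : P2 d}
    {γ : Measure (Space d × Space d)} (hγ : γ ∈ transportPlans μ.toMeasure ν.toMeasure) :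
    (wassersteinTwo μ.toMeasure ν.toMeasure).toReal ^ 2 ≤ ∫ p, ‖p.1 - p.2‖ ^ 2 ∂γ := by
  rw [← ENNReal.toReal_pow, wassersteinTwo_sq]
  refine ENNReal.toReal_le_of_le_ofReal (integral_nonneg fun p => sq_nonneg _) ?_
  exact (iInf₂_le γ hγ).trans (lintegral_edist_sq_of_mem_transportPlans hγ).le

theorem exists_transportPlan_integral_lt (μ ν : P2 d) {ε : ℝ} (hε : 0 < ε) :
    ∃ γ ∈ transportPlans μ.toMeasure ν.toMeasure,
      ∫ p, ‖p.1 - p.2‖ ^ 2 ∂γ < (wassersteinTwo μ.toMeasure ν.toMeasure).toReal ^ 2 + ε := by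
  have hlt : (⨅ γ ∈ transportPlans μ.toMeasure ν.toMeasure, ∫⁻ p, edist p.1 p.2 ^ 2 ∂γ) <
      ENNReal.ofReal ((wassersteinTwo μ.toMeasure ν.toMeasure).toReal ^ 2 + ε) := by
    rw [← wassersteinTwo_sq, ← ENNReal.ofReal_toReal
      (ENNReal.pow_ne_top (n := 2) (wassersteinTwo_ne_top μ ν)), ENNReal.toReal_pow]
    exact (ENNReal.ofReal_lt_ofReal_iff (by positivity)).2 (by linarith)
  obtain ⟨γ, hγ, h⟩ := by simpa only [iInf_lt_iff, exists_prop] using hlt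
  rw [lintegral_edist_sq_of_mem_transportPlans hγ] at h
  exact ⟨γ, hγ, (ENNReal.ofReal_lt_ofReal_iff (by positivity)).1 h⟩

/-- The convex function is even and vanishes at `0`, the midpoint of `z` and `-z`. -/
theorem IsAdmissiblePotential.lower_bound {W : Space d → ℝ} {l₁ l₂ : ℝ}
    (hW : IsAdmissiblePotential W l₁ l₂) (z : Space d) :
    -(l₂ / 2 * ‖z‖ ^ 2 + l₁ * ‖z‖) ≤ W z := by
  have h := hW.convexOn.2 (Set.mem_univ z) (Set.mem_univ (-z))
    (by norm_num : (0 : ℝ) ≤ 1 / 2) (by norm_num : (0 : ℝ) ≤ 1 / 2) (by norm_num)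
  simp only [smul_neg, add_neg_cancel, hW.map_zero, hW.even, norm_neg, norm_zero,
    smul_eq_mul] at h
  nlinarith

/-- The penalized energy density on pairs `(x₁, y₁), (x₂, y₂)` of points of a transport plan,
shifted by a quadratic function of `y₁, y₂`. -/
noncomputable def penalizedDensity (W : Space d → ℝ) (τ K : ℝ)
    (p : (Space d × Space d) × (Space d × Space d)) : ℝ :=
  1 / 2 * W (p.1.1 - p.2.1) + 1 / (4 * τ) * (‖p.1.1 - p.1.2‖ ^ 2 + ‖p.2.1 - p.2.2‖ ^ 2)
    + K * (1 + ‖p.1.2‖ ^ 2 + ‖p.2.2‖ ^ 2)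

theorem IsAdmissiblePotential.continuous_penalizedDensity {W : Space d → ℝ} {l₁ l₂ : ℝ}
    (hW : IsAdmissiblePotential W l₁ l₂) (τ K : ℝ) : Continuous (penalizedDensity W τ K) := by
  have := hW.continuous
  unfold penalizedDensity
  fun_prop

/-- The smallness of `τ` means `3 * l ≤ 1 / (4 * τ)`, twice what absorbing the `|xᵢ - yᵢ|²` terms
requires; `K = 3 * l` absorbs the `|yᵢ|²` terms exactly. -/
theorem IsAdmissiblePotential.penalizedDensity_nonneg {W : Space d → ℝ} {l₁ l₂ : ℝ}
    (hW : IsAdmissiblePotential W l₁ l₂) {τ l : ℝ} (hτ : 0 < τ) (hl₁ : l₁ ≤ l) (hl₂ : l₂ ≤ l)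
    (hτl : 12 * τ * l ≤ 1) : 0 ≤ penalizedDensity W τ (3 * l) := by
  rintro ⟨⟨x₁, y₁⟩, ⟨x₂, y₂⟩⟩
  simp only [Pi.zero_apply, penalizedDensity]
  have hl : 0 ≤ l := hW.nonneg_left.trans hl₁
  have hτ' : 3 * l ≤ 1 / (4 * τ) := by
    rw [le_div_iff₀ (by positivity)]; linarith
  have hlow := hW.lower_bound (x₁ - x₂)
  have htri : ‖x₁ - x₂‖ ≤ ‖x₁ - y₁‖ + ‖x₂ - y₂‖ + (‖y₁‖ + ‖y₂‖) := by
    have h : x₁ - x₂ = (x₁ - y₁) - (x₂ - y₂) + (y₁ - y₂) := by abel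
    rw [h]
    exact (norm_add_le _ _).trans (add_le_add (norm_sub_le _ _) (norm_sub_le _ _))
  have hcost : 3 * l * (‖x₁ - y₁‖ ^ 2 + ‖x₂ - y₂‖ ^ 2) ≤
      1 / (4 * τ) * (‖x₁ - y₁‖ ^ 2 + ‖x₂ - y₂‖ ^ 2) :=
    mul_le_mul_of_nonneg_right hτ' (by positivity)
  have hr := norm_nonneg (x₁ - x₂)
  set r := ‖x₁ - x₂‖
  set a := ‖x₁ - y₁‖
  set b := ‖x₂ - y₂‖
  set u := ‖y₁‖
  set v := ‖y₂‖
  -- Cauchy–Schwarz on the three terms `a`, `b`, `u + v`, then on `u + v`.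
  have hr2 : r ^ 2 ≤ 3 * (a ^ 2 + b ^ 2) + 6 * (u ^ 2 + v ^ 2) := by
    have h : r ^ 2 ≤ (a + b + (u + v)) ^ 2 := pow_le_pow_left₀ hr htri 2
    nlinarith [sq_nonneg (a - b), sq_nonneg (a - (u + v)), sq_nonneg (b - (u + v)),
      sq_nonneg (u - v)]
  have hquad : l₂ / 2 * r ^ 2 + l₁ * r ≤ l * (r ^ 2 + 1 / 2) := by
    have h₁ : l₁ * r ≤ l * r := mul_le_mul_of_nonneg_right hl₁ hr
    have h₂ : l₂ * r ^ 2 ≤ l * r ^ 2 := mul_le_mul_of_nonneg_right hl₂ (sq_nonneg r)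
    have h₃ : 0 ≤ l * (r - 1) ^ 2 := by positivity
    linarith
  have hfin : l * r ^ 2 ≤ l * (3 * (a ^ 2 + b ^ 2) + 6 * (u ^ 2 + v ^ 2)) :=
    mul_le_mul_of_nonneg_left hr2 hl
  have h₄ : 0 ≤ l * (a ^ 2 + b ^ 2) := by positivity
  linarith

/-- The two copies of the cost, each weighted `1 / (4 * τ)`, add up to `1 / (2 * τ)`; the shift sees
only `ν`. -/
theorem IsAdmissiblePotential.integrable_penalizedDensity {W : Space d → ℝ} {l₁ l₂ : ℝ}
    (hW : IsAdmissiblePotential W l₁ l₂) (τ K : ℝ) {μ ν : P2 d}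
    {γ : Measure (Space d × Space d)} (hγ : γ ∈ transportPlans μ.toMeasure ν.toMeasure) :
    Integrable (penalizedDensity W τ K) (γ.prod γ) ∧
      ∫ p, penalizedDensity W τ K p ∂(γ.prod γ) = interactionEnergy W μ.toMeasure
        + 1 / (2 * τ) * ∫ p, ‖p.1 - p.2‖ ^ 2 ∂γ
        + K * (1 + 2 * ∫ y, ‖y‖ ^ 2 ∂ν.toMeasure) := by
  have := isProbabilityMeasure_of_mem_transportPlans hγ
  have hprod : (γ.prod γ).map (Prod.map Prod.fst Prod.fst) = μ.toMeasure.prod μ.toMeasure := by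
    rw [← Measure.map_prod_map _ _ measurable_fst measurable_fst, hγ.1]
  have hmeas : Measurable (Prod.map Prod.fst Prod.fst :
      (Space d × Space d) × (Space d × Space d) → Space d × Space d) :=
    measurable_fst.prodMap measurable_fst
  have hWc := hW.continuous
  have hWi : Integrable (fun p : (Space d × Space d) × (Space d × Space d) =>
      W (p.1.1 - p.2.1)) (γ.prod γ) :=
    Integrable.comp_measurable (g := fun p : Space d × Space d => W (p.1 - p.2))
      (hprod ▸ integrable_interaction hW μ) hmeas
  have hWe : ∫ p, W (p.1.1 - p.2.1) ∂(γ.prod γ) =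
      ∫ p, W (p.1 - p.2) ∂(μ.toMeasure.prod μ.toMeasure) := by
    rw [← hprod, integral_map hmeas.aemeasurable (by fun_prop)]
    rfl
  have hci := integrable_norm_sub_sq_of_mem_transportPlans hγ
  have hyi := integrable_norm_snd_sq_of_mem_transportPlans hγ
  have hye : ∫ p, ‖p.2‖ ^ 2 ∂γ = ∫ y, ‖y‖ ^ 2 ∂ν.toMeasure := by
    rw [← hγ.2, integral_map measurable_snd.aemeasurable (by fun_prop)]
  have hc₁ := hci.comp_fst γ
  have hc₂ := hci.comp_snd γ
  have hy₁ := hyi.comp_fst γ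
  have hy₂ := hyi.comp_snd γ
  have hI₁ := hWi.const_mul (1 / 2)
  have hI₂ := (hc₁.add hc₂).const_mul (1 / (4 * τ))
  have hI₃ := (((integrable_const (μ := γ.prod γ) (1 : ℝ)).add hy₁).add hy₂).const_mul K
  refine ⟨(hI₁.add hI₂).add hI₃, ?_⟩
  refine (integral_add (hI₁.add hI₂) hI₃).trans ?_
  congr 1
  · refine (integral_add hI₁ hI₂).trans ?_
    congr 1
    · rw [integral_const_mul, hWe, interactionEnergy]
    · rw [integral_const_mul]
      have h : ∫ p, ‖p.1.1 - p.1.2‖ ^ 2 + ‖p.2.1 - p.2.2‖ ^ 2 ∂(γ.prod γ) =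
          2 * ∫ p, ‖p.1 - p.2‖ ^ 2 ∂γ := by
        rw [integral_add hc₁ hc₂, integral_fun_fst (fun p : Space d × Space d => ‖p.1 - p.2‖ ^ 2),
          integral_fun_snd (fun p : Space d × Space d => ‖p.1 - p.2‖ ^ 2)]
        simp [two_mul]
      refine (congrArg _ h).trans ?_
      field_simp
      norm_num
  · rw [integral_const_mul]
    congr 1
    refine (integral_add ((integrable_const (1 : ℝ)).add hy₁) hy₂).trans ?_
    refine (congrArg (· + _) (integral_add (integrable_const (1 : ℝ)) hy₁)).trans ?_
    rw [integral_fun_fst (fun p : Space d × Space d => ‖p.2‖ ^ 2),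
      integral_fun_snd (fun p : Space d × Space d => ‖p.2‖ ^ 2), hye]
    simp
    ring

end Interaction

theorem mainTheorem5 (d : ℕ) (W : Space d → ℝ) (l₁ l₂ : ℝ)
    (hW : IsAdmissiblePotential W l₁ l₂) (μbar : P2 d) (τ : ℝ) (hτ : 0 < τ)
    (hτl : 12 * τ * max 0 (max l₁ l₂) ≤ 1) :
    LowerSemicontinuous fun μ : P2 d => penalizedEnergy W τ μbar μ := by
  set l := max 0 (max l₁ l₂)
  have hl₁ : l₁ ≤ l := (le_max_left _ _).trans (le_max_right _ _)
  have hl₂ : l₂ ≤ l := (le_max_right _ _).trans (le_max_right _ _)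
  have hg0 := hW.penalizedDensity_nonneg hτ hl₁ hl₂ hτl
  have hgc := hW.continuous_penalizedDensity τ (3 * l)
  set M := 3 * l * (1 + 2 * ∫ y, ‖y‖ ^ 2 ∂μbar.toMeasure)
  -- Sublevel sets need only be sequentially closed, the narrow topology here being sequential.
  rw [lowerSemicontinuous_iff_isClosed_preimage]
  refine fun c => IsSeqClosed.isClosed fun μs μ hμs hμ => ?_
  refine le_of_forall_pos_le_add (α := ℝ) fun ε hε => ?_
  -- An excess cost of `2 * τ * ε` becomes `ε` after the factor `1 / (2 * τ)`; optimal plans are not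
  -- needed.
  choose γs hγs hlt using fun n =>
    exists_transportPlan_integral_lt (μs n) μbar (ε := 2 * τ * ε) (by positivity)
  have hprob n := isProbabilityMeasure_of_mem_transportPlans (hγs n)
  obtain ⟨γ, hγ₁, hγ₂, φ, -, hlim⟩ := exists_subseq_tendsto_coupling
    (μs := fun n => (μs n).1) (μ := μ.1) (ν := μbar.1) (γs := fun n => ⟨γs n, hprob n⟩)
    ((continuous_subtype_val.tendsto μ).comp hμ)
    (fun n => Subtype.ext (hγs n).1) (fun n => Subtype.ext (hγs n).2)
  have hγ : (γ : Measure _) ∈ transportPlans μ.toMeasure μbar.toMeasure :=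
    ⟨congrArg Subtype.val hγ₁, congrArg Subtype.val hγ₂⟩
  have hbound : ∀ n, ∫ p, penalizedDensity W τ (3 * l) p ∂((γs n).prod (γs n)) ≤ c + ε + M := by
    intro n
    rw [(hW.integrable_penalizedDensity τ (3 * l) (hγs n)).2]
    have hn : penalizedEnergy W τ μbar (μs n) ≤ c := hμs n
    have h := mul_le_mul_of_nonneg_left (hlt n).le (by positivity : 0 ≤ 1 / (2 * τ))
    have h' : 1 / (2 * τ) * (2 * τ * ε) = ε := by field_simp
    rw [mul_add, h'] at h
    rw [penalizedEnergy] at hn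
    linarith
  have hpos : 0 ≤ c + ε + M := (integral_nonneg hg0).trans (hbound 0)
  have hlimprod := (ProbabilityMeasure.continuous_prod.tendsto (γ, γ)).comp
    (hlim.prodMk_nhds hlim)
  have hle := lintegral_le_of_tendsto_of_forall_le hlimprod hgc hg0
    (c := ENNReal.ofReal (c + ε + M)) fun n => by
      refine (ofReal_integral_eq_lintegral_ofReal
        (hW.integrable_penalizedDensity τ (3 * l) (hγs (φ n))).1
        (Eventually.of_forall hg0)).symm.trans_le ?_
      exact ENNReal.ofReal_le_ofReal (hbound (φ n))
  obtain ⟨hint, heq⟩ := hW.integrable_penalizedDensity τ (3 * l) hγ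
  have hle' := (ofReal_integral_eq_lintegral_ofReal hint (Eventually.of_forall hg0)).trans_le hle
  rw [ENNReal.ofReal_le_ofReal_iff hpos, heq] at hle'
  -- The limit plan need not be optimal: its cost bounds `W₂²` from above, and `M` cancels.
  have hW₂ := mul_le_mul_of_nonneg_left (toReal_wassersteinTwo_sq_le_integral hγ)
    (by positivity : 0 ≤ 1 / (2 * τ))
  change penalizedEnergy W τ μbar μ ≤ c + ε
  rw [penalizedEnergy]
  linarith
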